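/- All rings are commutative with unity, and all monoids are commutative, cancellative and torsion-free (if $x^n=y^n$ for some $n\ge 1$, then $x=y$). A monoid is called *positive* if its only invertible element is the identity, and *affine* if it is finitely generated. An extension of rings $A\subset C$ is *elementary subintegral* if $C=A[b]$ for some $b\in C$ with $b^2,b^3\in A$; an extension of monoids $M\subset L$ is *elementary subintegral* if $L=M\cup xM$ for some $x\in L$ with $x^2,x^3\in M$. An extension of rings (resp. monoids) is *subintegral* if the larger object is a union of subrings (resp. submonoids) each of which is obtained from the smaller one by a finite succession of elementary subintegral extensions. For an extension of rings $A\subset B$ (resp. of monoids $M\subset N$), the *subintegral closure* of $A$ in $B$ (resp. of $M$ in $N$) is the largest subintegral extension of $A$ inside $B$ (resp. of $M$ inside $N$); $A$ (resp. $M$) is *subintegrally closed* in $B$ (resp. $N$) if it equals its subintegral closure there. **Statement.** Let $A\subset B$ be an extension of rings and $M\subset N$ an extension of positive monoids such that $A$ is subintegrally closed in $B$ and $M$ is subintegrally closed in $N$. Write $A[M]\subset B[N]$ for the corresponding monoid algebras. (i) If $B$ is reduced or $M=N$, then $A[M]$ is subintegrally closed in $B[N]$. (ii) Conversely, if $A[M]$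 is subintegrally closed in $B[N]$ and $N$ is affine, then $B$ is reduced or $M=N$. -/

import Mathlib

namespace SubintegralExt

section Rings

variable {B : Type*} [CommRing B]

/-- For subrings `A`, `C` of `B`: the extension `A ⊆ C` is elementary subintegral, that is
`C = A[b]` for some `b` with `b ^ 2 ∈ A` and `b ^ 3 ∈ A`. -/
def RingElementary (A C : Subring B) : Prop :=
  ∃ b : B, b ^ 2 ∈ A ∧ b ^ 3 ∈ A ∧ C = Subring.closure ((A : Set B) ∪ {b})

/-- `C` is obtained from `A` by a finite (possibly empty) succession of elementary subintegral
extensions. -/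
def RingFiniteSuccession (A C : Subring B) : Prop :=
  Relation.ReflTransGen RingElementary A C

/-- The extension `A ⊆ C` is subintegral: `C` is a union of subrings, each of which is obtained
from `A` by a finite succession of elementary subintegral extensions. -/
def RingSubintegral (A C : Subring B) : Prop :=
  ∀ c ∈ C, ∃ D : Subring B, RingFiniteSuccession A D ∧ D ≤ C ∧ c ∈ D

/-- The subintegral closure of `A` in `B`, the largest subintegral extension of `A` in `B`
(see `ringSubintegralClosure_isGreatest`). -/
def ringSubintegralClosure (A : Subring B) : Subring B :=
  sSup {C | RingSubintegral A C}

/-- `A` is subintegrally closed in `B`. -/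
def RingSubintegrallyClosed (A : Subring B) : Prop :=
  ringSubintegralClosure A = A

theorem RingElementary.sup {A C : Subring B} (h : RingElementary A C) (E : Subring B) :
    RingElementary (A ⊔ E) (C ⊔ E) := by
  obtain ⟨b, h2, h3, rfl⟩ := h
  refine ⟨b, le_sup_left (a := A) h2, le_sup_left (a := A) h3, ?_⟩
  simp only [Subring.closure_union, Subring.closure_eq]
  rw [sup_right_comm]

theorem RingFiniteSuccession.le {A C : Subring B} (h : RingFiniteSuccession A C) : A ≤ C := by
  induction h with
  | refl => exact le_rfl
  | tail _ h ih =>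
    obtain ⟨b, -, -, rfl⟩ := h
    exact ih.trans fun x hx => Subring.subset_closure (Or.inl hx)

theorem RingFiniteSuccession.sup {A C D : Subring B} (hC : RingFiniteSuccession A C)
    (hD : RingFiniteSuccession A D) : RingFiniteSuccession A (C ⊔ D) := by
  have h : RingFiniteSuccession (A ⊔ D) (C ⊔ D) :=
    Relation.ReflTransGen.lift (· ⊔ D) (fun _ _ h => h.sup D) _ _ hC
  rw [sup_eq_right.2 hD.le] at h
  exact Relation.ReflTransGen.trans hD h

theorem ringSubintegralClosure_isGreatest (A : Subring B) :
    IsGreatest {C | RingSubintegral A C} (ringSubintegralClosure A) := by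
  refine ⟨?_, fun C hC => le_sSup hC⟩
  have hT : ∀ D, RingFiniteSuccession A D → D ≤ ringSubintegralClosure A := fun D hD =>
    le_sSup (a := D) fun c hc => ⟨D, hD, le_rfl, hc⟩
  have hle : ringSubintegralClosure A ≤ sSup {D | RingFiniteSuccession A D} :=
    sSup_le fun C hC c hc => by
      obtain ⟨D, hD, -, hcD⟩ := hC c hc
      exact (le_sSup (a := D) hD) hcD
  intro c hc
  have hdir : DirectedOn (· ≤ ·) {D : Subring B | RingFiniteSuccession A D} :=
    fun C hC D hD => ⟨C ⊔ D, hC.sup hD, le_sup_left, le_sup_right⟩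
  obtain ⟨D, hD, hcD⟩ :=
    (Subring.mem_sSup_of_directedOn ⟨A, Relation.ReflTransGen.refl⟩ hdir).1 (hle hc)
  exact ⟨D, hD, hT D hD, hcD⟩

end Rings

section Monoids

variable {N : Type*} [CommMonoid N]

/-- For submonoids `M`, `L` of `N`: the extension `M ⊆ L` is elementary subintegral, that is
`L = M ∪ xM` for some `x` with `x ^ 2 ∈ M` and `x ^ 3 ∈ M`. -/
def MonoidElementary (M L : Submonoid N) : Prop :=
  ∃ x : N, x ^ 2 ∈ M ∧ x ^ 3 ∈ M ∧ (L : Set N) = (M : Set N) ∪ (fun m => x * m) '' (M : Set N)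

/-- `L` is obtained from `M` by a finite (possibly empty) succession of elementary subintegral
extensions. -/
def MonoidFiniteSuccession (M L : Submonoid N) : Prop :=
  Relation.ReflTransGen MonoidElementary M L

/-- The extension `M ⊆ L` is subintegral: `L` is a union of submonoids, each of which is obtained
from `M` by a finite succession of elementary subintegral extensions. -/
def MonoidSubintegral (M L : Submonoid N) : Prop :=
  ∀ c ∈ L, ∃ D : Submonoid N, MonoidFiniteSuccession M D ∧ D ≤ L ∧ c ∈ D

/-- The subintegral closure of `M` in `N`, the largest subintegral extension of `M` in `N`
(see `monoidSubintegralClosure_isGreatest`). -/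
def monoidSubintegralClosure (M : Submonoid N) : Submonoid N :=
  sSup {L | MonoidSubintegral M L}

/-- `M` is subintegrally closed in `N`. -/
def MonoidSubintegrallyClosed (M : Submonoid N) : Prop :=
  monoidSubintegralClosure M = M

/-- A monoid is positive if its group of units is trivial. -/
def IsPositive (M : Type*) [CommMonoid M] : Prop :=
  ∀ u : Mˣ, u = 1

theorem MonoidElementary.sup {M L : Submonoid N} (h : MonoidElementary M L) (E : Submonoid N) :
    MonoidElementary (M ⊔ E) (L ⊔ E) := by
  obtain ⟨x, h2, h3, hL⟩ := h
  refine ⟨x, le_sup_left (a := M) h2, le_sup_left (a := M) h3, ?_⟩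
  have hmem : ∀ y, y ∈ L ↔ y ∈ M ∨ ∃ m ∈ M, x * m = y := fun y => by
    rw [← SetLike.mem_coe, hL]; simp
  ext y
  simp only [SetLike.mem_coe, Set.mem_union, Set.mem_image, Submonoid.mem_sup]
  constructor
  · rintro ⟨l, hl, e, he, rfl⟩
    rcases (hmem l).1 hl with hl | ⟨m, hm, rfl⟩
    · exact Or.inl ⟨l, hl, e, he, rfl⟩
    · exact Or.inr ⟨m * e, ⟨m, hm, e, he, rfl⟩, (mul_assoc _ _ _).symm⟩
  · rintro (⟨m, hm, e, he, rfl⟩ | ⟨_, ⟨m, hm, e, he, rfl⟩, rfl⟩)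
    · exact ⟨m, (hmem m).2 (Or.inl hm), e, he, rfl⟩
    · exact ⟨x * m, (hmem _).2 (Or.inr ⟨m, hm, rfl⟩), e, he, mul_assoc _ _ _⟩

theorem MonoidFiniteSuccession.le {M L : Submonoid N} (h : MonoidFiniteSuccession M L) :
    M ≤ L := by
  induction h with
  | refl => exact le_rfl
  | tail _ h ih =>
    obtain ⟨x, -, -, hL⟩ := h
    exact ih.trans fun y hy => by
      rw [← SetLike.mem_coe, hL]
      exact Or.inl hy

theorem MonoidFiniteSuccession.sup {M L D : Submonoid N} (hL : MonoidFiniteSuccession M L)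
    (hD : MonoidFiniteSuccession M D) : MonoidFiniteSuccession M (L ⊔ D) := by
  have h : MonoidFiniteSuccession (M ⊔ D) (L ⊔ D) :=
    Relation.ReflTransGen.lift (· ⊔ D) (fun _ _ h => h.sup D) _ _ hL
  rw [sup_eq_right.2 hD.le] at h
  exact Relation.ReflTransGen.trans hD h

theorem monoidSubintegralClosure_isGreatest (M : Submonoid N) :
    IsGreatest {L | MonoidSubintegral M L} (monoidSubintegralClosure M) := by
  refine ⟨?_, fun L hL => le_sSup hL⟩
  have hT : ∀ D, MonoidFiniteSuccession M D → D ≤ monoidSubintegralClosure M := fun D hD =>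
    le_sSup (a := D) fun c hc => ⟨D, hD, le_rfl, hc⟩
  have hle : monoidSubintegralClosure M ≤ sSup {D | MonoidFiniteSuccession M D} :=
    sSup_le fun L hL c hc => by
      obtain ⟨D, hD, -, hcD⟩ := hL c hc
      exact (le_sSup (a := D) hD) hcD
  intro c hc
  have hdir : DirectedOn (· ≤ ·) {D : Submonoid N | MonoidFiniteSuccession M D} :=
    fun L hL D hD => ⟨L ⊔ D, hL.sup hD, le_sup_left, le_sup_right⟩
  obtain ⟨D, hD, hcD⟩ :=
    (Submonoid.mem_sSup_of_directedOn ⟨M, Relation.ReflTransGen.refl⟩ hdir).1 (hle hc)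
  exact ⟨D, hD, hT D hD, hcD⟩

end Monoids

/-- The monoid algebra `A[M]`, as a subring of the monoid algebra `B[N]`: the image of the
natural map `A[M] → B[N]` induced by the inclusions `A ⊆ B` and `M ⊆ N`. -/
noncomputable def monoidSubalgebra {B N : Type*} [CommRing B] [CommMonoid N]
    (A : Subring B) (M : Submonoid N) : Subring (MonoidAlgebra B N) :=
  ((MonoidAlgebra.mapDomainRingHom B M.subtype).comp
    (MonoidAlgebra.mapRingHom M A.subtype)).range

end SubintegralExt

namespace SubintegralExt

/-! ### Closedness as the condition on squares and cubes -/

section Closed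

/-! Subintegral closedness means that `x ^ 2` and `x ^ 3` in the subobject force `x` into it. Let `f
^ 2` and `f ^ 3` lie in `A[M]`, and order `N` linearly. The leading term `t` of `f` lies in `A[M]`,
because its square and cube are read off from `f ^ 2` and `f ^ 3`. If also `t * f` lies in `A[M]`,
then `f - t` inherits the hypotheses with fewer terms (`mem_of_exists_term`).

For `t * f`, compare coefficients in `f ^ 2 * f = f ^ 3`, descending from the top: some power of the
leading coefficient `a` multiplies each coefficient `b` into `A`. Moreover `b` is integral over `A`
(`isIntegral_coeff_of_sq`), so all high powers of `a * b` lie in `A`, and hence so does `a * b`.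
Exponents obey the same argument over a domain, integrality being replaced by "some power lies in
`M`" (`exists_pow_mem_of_sq`); a reduced `B` is handled modulo its primes.

Conversely, if `b ≠ 0`, `b ^ 2 = 0` and `n ∉ M`, the monomial with exponent `n` and coefficient `b`
has zero square and cube but is not in `A[M]`. -/

/-- The bound `J + 1` drops to `J`: for `J ≥ 1`, the square and cube of `x ^ J` have exponents at
least `J + 1`. -/
theorem mem_of_forall_pow_mem {G : Type*} [Monoid G] {T : Submonoid G}
    (hT : ∀ x, x ^ 2 ∈ T → x ^ 3 ∈ T → x ∈ T) {x : G} {J : ℕ} (h : ∀ j ≥ J, x ^ j ∈ T) :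
    x ∈ T := by
  induction J with
  | zero => simpa using h 1 (by simp)
  | succ J ih =>
    rcases Nat.eq_zero_or_pos J with rfl | hJ
    · simpa using h 1 (by simp)
    refine ih fun j hj => ?_
    rcases hj.eq_or_lt with rfl | hj
    · rcases Nat.lt_or_ge J 2 with h2 | h2
      · obtain rfl : J = 1 := by omega
        refine hT _ ?_ ?_
        · rw [← pow_mul]; exact h _ (by omega)
        · rw [← pow_mul]; exact h _ (by omega)
      · refine hT _ ?_ ?_
        · rw [← pow_mul]; exact h _ (by omega)
        · rw [← pow_mul]; exact h _ (by omega)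
    · exact h j hj

theorem ringSubintegrallyClosed_iff {B : Type*} [CommRing B] {A : Subring B} :
    RingSubintegrallyClosed A ↔ ∀ b : B, b ^ 2 ∈ A → b ^ 3 ∈ A → b ∈ A := by
  constructor
  · intro h b h2 h3
    have hE : RingElementary A (Subring.closure ((A : Set B) ∪ {b})) := ⟨b, h2, h3, rfl⟩
    rw [← (show ringSubintegralClosure A = A from h)]
    exact le_sSup (a := Subring.closure ((A : Set B) ∪ {b}))
      (fun c hc => ⟨_, Relation.ReflTransGen.single hE, le_rfl, hc⟩)
      (Subring.subset_closure (Or.inr rfl))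
  · intro h
    have hfin : ∀ D, RingFiniteSuccession A D → D = A := by
      intro D hD
      induction hD with
      | refl => rfl
      | tail _ hE ih =>
        subst ih
        obtain ⟨b, h2, h3, rfl⟩ := hE
        rw [Set.union_eq_left.2 (Set.singleton_subset_iff.2 (h b h2 h3)), Subring.closure_eq]
    refine le_antisymm (sSup_le fun C hC c hc => ?_)
      (le_sSup fun c hc => ⟨A, Relation.ReflTransGen.refl, le_rfl, hc⟩)
    obtain ⟨D, hD, -, hcD⟩ := hC c hc
    rwa [hfin D hD] at hcD

theorem MonoidSubintegrallyClosed.mem {N : Type*} [CommMonoid N] {M : Submonoid N}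
    (h : MonoidSubintegrallyClosed M) (x : N) (h2 : x ^ 2 ∈ M) (h3 : x ^ 3 ∈ M) : x ∈ M := by
  let L : Submonoid N :=
    { carrier := (M : Set N) ∪ (fun m => x * m) '' (M : Set N)
      one_mem' := Or.inl M.one_mem
      mul_mem' := by
        rintro a b (ha | ⟨a, ha, rfl⟩) (hb | ⟨b, hb, rfl⟩)
        · exact Or.inl (M.mul_mem ha hb)
        · exact Or.inr ⟨a * b, M.mul_mem ha hb, mul_left_comm _ _ _⟩
        · exact Or.inr ⟨a * b, M.mul_mem ha hb, (mul_assoc _ _ _).symm⟩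
        · refine Or.inl ?_
          have : x * a * (x * b) = x ^ 2 * (a * b) := by rw [sq, mul_mul_mul_comm]
          change x * a * (x * b) ∈ M
          rw [this]
          exact M.mul_mem h2 (M.mul_mem ha hb) }
  have hE : MonoidElementary M L := ⟨x, h2, h3, rfl⟩
  rw [← (show monoidSubintegralClosure M = M from h)]
  exact le_sSup (a := L) (fun c hc => ⟨L, Relation.ReflTransGen.single hE, le_rfl, hc⟩)
    (Or.inr ⟨1, M.one_mem, mul_one x⟩)

end Closed

/-! ### Linear orders adapted to a submonoid -/

section Order

/-- A submonoid without nontrivial units of a torsion-free abelian group is contained in the set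
of elements at least `1` for some linear order on the group. -/
theorem exists_linearOrder_of_pointed {G : Type*} [CommGroup G] [IsMulTorsionFree G]
    (P : Submonoid G) (hP : ∀ x ∈ P, x⁻¹ ∈ P → x = 1) :
    ∃ _ : LinearOrder G, IsOrderedMonoid G ∧ ∀ x ∈ P, 1 ≤ x := by
  obtain ⟨V, hPV, hV⟩ := zorn_le_nonempty₀ {V : Submonoid G | ∀ x ∈ V, x⁻¹ ∈ V → x = 1}
    (fun c hc hchain y hy => by
      have hdir := hchain.directedOn
      refine ⟨sSup c, fun x hx hx' => ?_, fun z hz => le_sSup hz⟩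
      obtain ⟨V, hV, hxV⟩ := (Submonoid.mem_sSup_of_directedOn ⟨y, hy⟩ hdir).1 hx
      obtain ⟨W, hW, hxW⟩ := (Submonoid.mem_sSup_of_directedOn ⟨y, hy⟩ hdir).1 hx'
      obtain ⟨U, hU, hVU, hWU⟩ := hdir V hV W hW
      exact hc hU x (hVU hxV) (hWU hxW)) P hP
  -- By maximality, adjoining `x` to `V` must create a nontrivial unit; the resulting relation puts
  -- a positive power of `x⁻¹` in `V`.
  have key : ∀ x, x ∉ V → ∃ k ≥ 1, x⁻¹ ^ k ∈ V := by
    intro x hx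
    by_contra! hk
    refine hx ((hV.le_of_ge (y := V ⊔ Submonoid.powers x) ?_ le_sup_left)
      (le_sup_right (a := V) (Submonoid.mem_powers x)))
    intro y hy hy'
    obtain ⟨v, hv, _, ⟨i, rfl⟩, rfl⟩ := Submonoid.mem_sup.1 hy
    obtain ⟨w, hw, _, ⟨j, rfl⟩, hwj⟩ := Submonoid.mem_sup.1 hy'
    have hvw : v * w = x⁻¹ ^ (i + j) := by
      have h1 : w * x ^ j * (v * x ^ i) = 1 := by rw [hwj]; simp
      rw [inv_pow, eq_inv_iff_mul_eq_one, ← h1, pow_add]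
      simp only [mul_assoc, mul_comm, mul_left_comm]
    have hij : i + j = 0 := by
      by_contra h0
      exact hk (i + j) (by omega) (hvw ▸ V.mul_mem hv hw)
    obtain ⟨rfl, rfl⟩ : i = 0 ∧ j = 0 := by omega
    simp only [pow_zero, mul_one] at hwj ⊢
    exact hV.1 v hv (hwj ▸ hw)
  -- If neither `x` nor `x⁻¹` were in `V`, a positive power of `x` would be a unit of `V`, making
  -- `x` torsion.
  have htot : ∀ x, x ∈ V ∨ x⁻¹ ∈ V := by
    intro x
    by_contra! hx
    obtain ⟨k, hk, hxk⟩ := key x hx.1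
    obtain ⟨l, hl, hxl⟩ := key x⁻¹ hx.2
    rw [inv_inv] at hxl
    have h1 : x ^ (k * l) = 1 := by
      refine hV.1 _ ?_ ?_
      · rw [mul_comm, pow_mul]; exact V.pow_mem hxl k
      · rw [← inv_pow, pow_mul]; exact V.pow_mem hxk l
    have : x = 1 := (pow_eq_one_iff_left (by positivity)).1 h1
    exact hx.1 (this ▸ V.one_mem)
  classical
  let C : GroupCone G := { V with eq_one_of_mem_of_inv_mem' := fun {a} => hV.1 a }
  have : HasMemOrInvMem C := ⟨htot⟩
  refine ⟨LinearOrder.mkOfGroupCone C, IsOrderedMonoid.mkOfCone C, fun x hx => ?_⟩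
  change x / 1 ∈ V
  rw [div_one]
  exact hPV hx

variable {N : Type*} [CancelCommMonoid N] [IsMulTorsionFree N]

theorem exists_linearOrder_of_map_pointed (P : Submonoid (Algebra.GrothendieckGroup N))
    (hP : ∀ x ∈ P, x⁻¹ ∈ P → x = 1) :
    ∃ _ : LinearOrder N, IsOrderedCancelMonoid N ∧
      ∀ x y : N, Algebra.GrothendieckGroup.of y / Algebra.GrothendieckGroup.of x ∈ P → x ≤ y := by
  obtain ⟨l, hl, h⟩ := exists_linearOrder_of_pointed P hP
  have hinj := Algebra.GrothendieckGroup.of_injective (M := N)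
  let _ : LinearOrder N := LinearOrder.lift' Algebra.GrothendieckGroup.of hinj
  have hle : ∀ x y : N, x ≤ y ↔
    Algebra.GrothendieckGroup.of x ≤ Algebra.GrothendieckGroup.of y := fun _ _ => Iff.rfl
  refine ⟨inferInstance, Function.Injective.isOrderedCancelMonoid _ (map_mul _) Iff.rfl,
    fun x y hxy => ?_⟩
  · rw [hle, ← one_le_div']
    exact h _ hxy

variable (N) in
theorem exists_linearOrder : ∃ _ : LinearOrder N, IsOrderedCancelMonoid N := by
  obtain ⟨l, h, -⟩ := exists_linearOrder_of_map_pointed (N := N) ⊥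
    (fun x hx _ => Submonoid.mem_bot.1 hx)
  exact ⟨l, h⟩

/-- In the Grothendieck group, `M` and `n⁻¹` generate a pointed cone: a unit gives `m' * m = n ^ (j
+ i)`, so `j + i = 0`, and then `m` is a unit of the positive monoid `M`. -/
theorem exists_linearOrder_lt_one {M : Submonoid N} (hM : IsPositive M) {n : N}
    (hn : ∀ k ≥ 1, n ^ k ∉ M) :
    ∃ _ : LinearOrder N, IsOrderedCancelMonoid N ∧ (∀ m ∈ M, 1 ≤ m) ∧ n < 1 := by
  let φ : N →* Algebra.GrothendieckGroup N := Algebra.GrothendieckGroup.of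
  have hinj : Function.Injective φ := Algebra.GrothendieckGroup.of_injective (M := N)
  obtain ⟨l, h, hle⟩ := exists_linearOrder_of_map_pointed
    (M.map φ ⊔ Submonoid.powers (φ n)⁻¹) (by
      intro x hx hx'
      obtain ⟨_, ⟨m, hm, rfl⟩, _, ⟨i, rfl⟩, rfl⟩ := Submonoid.mem_sup.1 hx
      obtain ⟨_, ⟨m', hm', rfl⟩, _, ⟨j, rfl⟩, hj⟩ := Submonoid.mem_sup.1 hx'
      have h1 : φ m' * (φ n)⁻¹ ^ j * (φ m * (φ n)⁻¹ ^ i) = 1 := by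
        have := congrArg (· * (φ m * (φ n)⁻¹ ^ i)) hj
        simpa using this
      have h2 : m' * m = n ^ (j + i) := hinj <| by
        rw [map_mul, map_pow, ← mul_inv_eq_one, ← h1, pow_add, mul_inv, inv_pow, inv_pow]
        simp only [mul_assoc, mul_comm, mul_left_comm]
      have hij : j + i = 0 := by
        by_contra h0
        exact hn (j + i) (by omega) (h2 ▸ M.mul_mem hm' hm)
      obtain ⟨rfl, rfl⟩ : j = 0 ∧ i = 0 := by omega
      simp only [add_zero, pow_zero] at h2
      have hu := hM ⟨⟨m, hm⟩, ⟨m', hm'⟩, Subtype.ext (by simpa [mul_comm] using h2),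
        Subtype.ext h2⟩
      have : m = 1 := congrArg (fun u : (M : Type _)ˣ => ((u : M) : N)) hu
      simp [this])
  refine ⟨l, h, fun m hm => hle _ _ ?_, lt_of_le_of_ne (hle _ _ ?_) ?_⟩
  · rw [map_one, div_one]
    exact le_sup_left (a := M.map φ) ⟨m, hm, rfl⟩
  · rw [map_one, one_div]
    exact le_sup_right (a := M.map φ) (Submonoid.mem_powers _)
  · rintro rfl
    exact hn 1 le_rfl (by simp)

end Order

/-! ### Coefficients of products and removal of terms -/

section MonoidAlgebra

theorem mem_monoidSubalgebra {B N : Type*} [CommRing B] [CommMonoid N] {A : Subring B}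
    {M : Submonoid N} {f : MonoidAlgebra B N} :
    f ∈ monoidSubalgebra A M ↔ (∀ n, f.coeff n ∈ A) ∧ ∀ n, f.coeff n ≠ 0 → n ∈ M := by
  classical
  constructor
  · rintro ⟨x, rfl⟩
    induction x using MonoidAlgebra.induction_linear with
    | zero => simp
    | add x y hx hy =>
      rw [map_add]
      refine ⟨fun n => ?_, fun n hn => ?_⟩
      · rw [MonoidAlgebra.coeff_add, Finsupp.add_apply]
        exact A.add_mem (hx.1 n) (hy.1 n)
      · by_contra hnM
        refine hn ?_
        rw [MonoidAlgebra.coeff_add, Finsupp.add_apply, not_not.1 (mt (hx.2 n) hnM),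
          not_not.1 (mt (hy.2 n) hnM), add_zero]
    | single m a =>
      have : ((MonoidAlgebra.mapDomainRingHom B M.subtype).comp
          (MonoidAlgebra.mapRingHom M A.subtype)) (MonoidAlgebra.single m a)
          = MonoidAlgebra.single (m : N) (a : B) := by simp
      rw [this]
      refine ⟨fun n => ?_, fun n hn => ?_⟩
      · rw [MonoidAlgebra.coeff_single, Finsupp.single_apply]
        split_ifs
        exacts [a.2, A.zero_mem]
      · rw [MonoidAlgebra.coeff_single, Finsupp.single_apply] at hn
        split_ifs at hn with h
        · exact h ▸ m.2
        · exact absurd rfl hn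
  · rintro ⟨hA, hM⟩
    rw [← MonoidAlgebra.sum_coeff_single f]
    refine Subring.sum_mem _ fun n hn => ?_
    refine ⟨MonoidAlgebra.single ⟨n, hM n (Finsupp.mem_support_iff.1 hn)⟩ ⟨f.coeff n, hA n⟩, ?_⟩
    simp

theorem single_mem_monoidSubalgebra {B N : Type*} [CommRing B] [CommMonoid N] {A : Subring B}
    {M : Submonoid N} {n : N} {a : B} (ha : a ∈ A) (hn : n ∈ M) :
    MonoidAlgebra.single n a ∈ monoidSubalgebra A M :=
  ⟨MonoidAlgebra.single ⟨n, hn⟩ ⟨a, ha⟩, by simp⟩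

/-- The subgroup `T` measures what is negligible: zero, a valuation ball, or the elements carried
into `A` by powers of `a`. -/
theorem coeff_mul_sub_mem {B N : Type*} [CommRing B] [Mul N] (T : AddSubgroup B)
    (x y : MonoidAlgebra B N) (m n : N)
    (h : ∀ p q, p * q = m * n → (p, q) ≠ (m, n) → x.coeff p * y.coeff q ∈ T) :
    (x * y).coeff (m * n) - x.coeff m * y.coeff n ∈ T := by
  classical
  have key : (x * y).coeff (m * n) - x.coeff m * y.coeff n =
      ∑ p ∈ (x.coeff.support ×ˢ y.coeff.support).erase (m, n),
        if p.1 * p.2 = m * n then x.coeff p.1 * y.coeff p.2 else 0 := by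
    have h1 : (x * y).coeff (m * n) = ∑ p ∈ x.coeff.support ×ˢ y.coeff.support,
        if p.1 * p.2 = m * n then x.coeff p.1 * y.coeff p.2 else 0 := by
      rw [MonoidAlgebra.coeff_mul, Finset.sum_product]
      rfl
    by_cases hmn : (m, n) ∈ x.coeff.support ×ˢ y.coeff.support
    · rw [h1, ← Finset.add_sum_erase _ _ hmn]
      simp
    · rw [Finset.erase_eq_of_notMem hmn, h1]
      have : x.coeff m * y.coeff n = 0 := by
        by_contra h0
        exact hmn (Finset.mem_product.2 ⟨Finsupp.mem_support_iff.2 (left_ne_zero_of_mul h0),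
          Finsupp.mem_support_iff.2 (right_ne_zero_of_mul h0)⟩)
      rw [this, sub_zero]
  rw [key]
  refine T.sum_mem fun p hp => ?_
  split_ifs with hpq
  · exact h p.1 p.2 hpq (Finset.ne_of_mem_erase hp)
  · exact T.zero_mem

theorem coeff_mul_of_unique {B N : Type*} [CommRing B] [Mul N]
    (x y : MonoidAlgebra B N) (m n : N)
    (h : ∀ p q, p * q = m * n → (p, q) ≠ (m, n) → x.coeff p * y.coeff q = 0) :
    (x * y).coeff (m * n) = x.coeff m * y.coeff n :=
  sub_eq_zero.1 (coeff_mul_sub_mem ⊥ x y m n h)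

theorem coeff_single_mul_mem {B N : Type*} [CommRing B] [CancelCommMonoid N] (n q : N) (a : B)
    (f : MonoidAlgebra B N) : (MonoidAlgebra.single n a * f).coeff (n * q) = a * f.coeff q :=
  MonoidAlgebra.coeff_single_mul_eq_mul_coeff _ fun _ _ => mul_right_inj n

theorem coeff_single_mul_ne_zero {B N : Type*} [CommRing B] [CancelCommMonoid N] {n m : N} {a : B}
    {f : MonoidAlgebra B N} (h : (MonoidAlgebra.single n a * f).coeff m ≠ 0) :
    ∃ q, m = n * q ∧ f.coeff q ≠ 0 := by
  by_cases hm : ∃ q, n * q = m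
  · obtain ⟨q, rfl⟩ := hm
    exact ⟨q, rfl, right_ne_zero_of_mul (coeff_single_mul_mem n q a f ▸ h)⟩
  · exact absurd (MonoidAlgebra.coeff_single_mul_of_forall_mul_ne _ _
      fun d hd => hm ⟨d, hd⟩) h

/-- An element `f` with `f ^ 2, f ^ 3 ∈ R` lies in `R` as soon as some term `t` of any such element
satisfies `t ∈ R` and `t * f ∈ R`, for then `f - t` is such an element with fewer terms. -/
theorem mem_of_exists_term {B N : Type*} [CommRing B] [CommMonoid N]
    (R : Subring (MonoidAlgebra B N))
    (hR : ∀ f : MonoidAlgebra B N, f ≠ 0 → f ^ 2 ∈ R → f ^ 3 ∈ R → ∃ n, f.coeff n ≠ 0 ∧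
      MonoidAlgebra.single n (f.coeff n) ∈ R ∧ MonoidAlgebra.single n (f.coeff n) * f ∈ R)
    (f : MonoidAlgebra B N) (h2 : f ^ 2 ∈ R) (h3 : f ^ 3 ∈ R) : f ∈ R := by
  classical
  induction hc : f.coeff.support.card using Nat.strong_induction_on generalizing f with
  | _ c ih =>
    by_cases hf : f = 0
    · exact hf ▸ R.zero_mem
    obtain ⟨n, hn, ht, htf⟩ := hR f hf h2 h3
    have hsum := MonoidAlgebra.single_add_erase n f
    set t := MonoidAlgebra.single n (f.coeff n) with htdef
    have he : f.erase n = f - t := eq_sub_of_add_eq' hsum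
    have hmem : f.erase n ∈ R := by
      refine ih _ ?_ _ ?_ ?_ rfl
      · rw [← hc, MonoidAlgebra.coeff_erase, Finsupp.support_erase]
        exact Finset.card_erase_lt_of_mem (Finsupp.mem_support_iff.2 hn)
      · rw [he, show (f - t) ^ 2 = f ^ 2 - 2 • (t * f) + t ^ 2 by rw [nsmul_eq_mul]; push_cast; ring]
        exact R.add_mem (R.sub_mem h2 (R.nsmul_mem htf 2)) (R.pow_mem ht 2)
      · rw [he, show (f - t) ^ 3 = f ^ 3 - 3 • (t * f ^ 2) + 3 • (t * (t * f)) - t ^ 3 by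
          rw [nsmul_eq_mul, nsmul_eq_mul]; push_cast; ring]
        exact R.sub_mem (R.add_mem (R.sub_mem h3 (R.nsmul_mem (R.mul_mem ht h2) 3))
          (R.nsmul_mem (R.mul_mem ht htf) 3)) (R.pow_mem ht 3)
    rw [← hsum]
    exact R.add_mem ht hmem

theorem exists_leading {B N : Type*} [CommRing B] [LinearOrder N] {f : MonoidAlgebra B N} (hf : f ≠ 0) :
    ∃ n, f.coeff n ≠ 0 ∧ ∀ m, n < m → f.coeff m = 0 := by
  have hne : f.coeff.support.Nonempty := Finsupp.support_nonempty_iff.2 (by simpa using hf)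
  refine ⟨f.coeff.support.max' hne, Finsupp.mem_support_iff.1 (Finset.max'_mem _ _),
    fun m hm => ?_⟩
  by_contra h
  exact absurd (Finset.le_max' _ m (Finsupp.mem_support_iff.2 h)) (not_le.2 hm)

theorem exists_maximal_coeff {B N : Type*} [CommRing B] [LinearOrder N] {f : MonoidAlgebra B N} {P : N → Prop} {n : N} (hn : f.coeff n ≠ 0)
    (hP : P n) : ∃ m, f.coeff m ≠ 0 ∧ P m ∧ ∀ q, m < q → f.coeff q ≠ 0 → ¬ P q := by
  classical
  obtain ⟨m, hm, hmax⟩ := (f.coeff.support.filter P).exists_max_image id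
    ⟨n, Finset.mem_filter.2 ⟨Finsupp.mem_support_iff.2 hn, hP⟩⟩
  rw [Finset.mem_filter, Finsupp.mem_support_iff] at hm
  refine ⟨m, hm.1, hm.2, fun q hq hfq hPq => ?_⟩
  exact absurd (hmax q (Finset.mem_filter.2 ⟨Finsupp.mem_support_iff.2 hfq, hPq⟩)) (not_le.2 hq)

section Ordered

variable {B N : Type*} [CommRing B] [CommMonoid N] [LinearOrder N] [IsOrderedCancelMonoid N]

theorem lt_or_lt_of_mul_eq {p q m n : N} (h : p * q = m * n) (hne : (p, q) ≠ (m, n)) :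
    m < p ∨ n < q := by
  by_contra! hle
  have hp : p = m := by
    by_contra hpm
    exact absurd h (mul_lt_mul_of_lt_of_le (lt_of_le_of_ne hle.1 hpm) hle.2).ne
  subst hp
  exact hne (Prod.ext rfl (mul_left_cancel h))

theorem coeff_mul_of_leading {x y : MonoidAlgebra B N} {m n : N}
    (hx : ∀ p, m < p → x.coeff p = 0) (hy : ∀ q, n < q → y.coeff q = 0) :
    (x * y).coeff (m * n) = x.coeff m * y.coeff n :=
  coeff_mul_of_unique x y m n fun p q hpq hne => by
    rcases lt_or_lt_of_mul_eq hpq hne with h | h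
    · rw [hx p h, zero_mul]
    · rw [hy q h, mul_zero]

theorem coeff_mul_of_lt {x y : MonoidAlgebra B N} {m n : N}
    (hx : ∀ p, m < p → x.coeff p = 0) (hy : ∀ q, n < q → y.coeff q = 0) (r : N)
    (hr : m * n < r) : (x * y).coeff r = 0 := by
  classical
  rw [MonoidAlgebra.coeff_mul]
  refine Finset.sum_eq_zero fun p hp => Finset.sum_eq_zero fun q hq => if_neg ?_
  rintro rfl
  have h1 : p ≤ m := not_lt.1 fun h => Finsupp.mem_support_iff.1 hp (hx p h)
  have h2 : q ≤ n := not_lt.1 fun h => Finsupp.mem_support_iff.1 hq (hy q h)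
  exact absurd hr (not_lt.2 (mul_le_mul' h1 h2))

end Ordered

end MonoidAlgebra

/-! ### Integrality of coefficients -/

section Integral

open Polynomial

/-- The values at `b` of monic polynomials form a multiplicative set avoiding `0`. Modulo a prime
disjoint from it, `b` stays non-integral, and an integrally closed subring of a field is cut out by
valuation rings. -/
theorem exists_valuationSubring_of_not_isIntegral {A B : Type*} [CommRing A] [CommRing B]
    [Algebra A B] {b : B} (hb : ¬ IsIntegral A b) :
    ∃ (P : Ideal B) (_ : P.IsPrime) (V : ValuationSubring (FractionRing (B ⧸ P))),
      (∀ a : A, algebraMap B (FractionRing (B ⧸ P)) (algebraMap A B a) ∈ V) ∧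
        algebraMap B (FractionRing (B ⧸ P)) b ∉ V := by
  let S : Submonoid B :=
    { carrier := {x | ∃ p : A[X], p.Monic ∧ aeval b p = x}
      one_mem' := ⟨1, monic_one, map_one _⟩
      mul_mem' := by
        rintro _ _ ⟨p, hp, rfl⟩ ⟨q, hq, rfl⟩
        exact ⟨p * q, hp.mul hq, map_mul _ _ _⟩ }
  obtain ⟨P, hP, -, hPS⟩ := Ideal.exists_le_prime_disjoint ⊥ S (by
    rw [Set.disjoint_left]
    rintro x hx ⟨p, hp, rfl⟩
    exact hb ⟨p, hp, by rwa [← aeval_def]⟩)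
  refine ⟨P, hP, ?_⟩
  let L := FractionRing (B ⧸ P)
  have hker : ∀ x : B, algebraMap B L x = 0 → x ∈ P := by
    intro x hx
    rw [IsScalarTower.algebraMap_apply B (B ⧸ P) L] at hx
    exact Ideal.Quotient.eq_zero_iff_mem.1 ((FaithfulSMul.algebraMap_eq_zero_iff _ _).1 hx)
  have hbL : algebraMap B L b ∉ (integralClosure A L).toSubring := by
    rintro ⟨p, hp, hpb⟩
    rw [← aeval_def, aeval_algebraMap_apply] at hpb
    exact Set.disjoint_left.1 hPS (hker _ hpb) ⟨p, hp, rfl⟩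
  obtain ⟨V, hV, hbV⟩ := Subring.exists_le_valuationSubring_of_isIntegrallyClosedIn hbL
  exact ⟨V, fun a => hV (by
    rw [← IsScalarTower.algebraMap_apply A B L]
    exact (integralClosure A L).algebraMap_mem a), hbV⟩

/-- If the coefficients of `f ^ 2` lie in `A`, then the coefficients of `f` are integral
over `A`. -/
theorem isIntegral_coeff_of_sq {B N : Type*} [CommRing B] [CommMonoid N] [LinearOrder N]
    [IsOrderedCancelMonoid N] {A : Subring B} {f : MonoidAlgebra B N}
    (hf : ∀ n, (f ^ 2).coeff n ∈ A) (n : N) : IsIntegral A (f.coeff n) := by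
  by_contra hn
  obtain ⟨P, hP, V, hAV, hnV⟩ := exists_valuationSubring_of_not_isIntegral hn
  set φ := algebraMap B (FractionRing (B ⧸ P))
  let v := V.valuation
  have hn0 : f.coeff n ≠ 0 := by
    intro h
    rw [h, map_zero] at hnV
    exact hnV V.zero_mem
  obtain ⟨n₀, -, hmax⟩ := f.coeff.support.exists_max_image (fun m => v (φ (f.coeff m)))
    ⟨n, Finsupp.mem_support_iff.2 hn0⟩
  have hone : 1 < v (φ (f.coeff n₀)) :=
    lt_of_lt_of_le (not_le.1 fun h => hnV ((V.valuation_le_one_iff _).1 h))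
      (hmax n (Finsupp.mem_support_iff.2 hn0))
  have hn₀ : f.coeff n₀ ≠ 0 := by
    intro h
    rw [h, map_zero, map_zero] at hone
    exact absurd hone (not_lt.2 zero_le)
  -- As in Gauss's lemma: among the coefficients of maximal value take the one with the largest
  -- exponent `m`; its square dominates the coefficient of `f ^ 2` at `m * m`.
  obtain ⟨m, hm0, hm, hmtop⟩ := exists_maximal_coeff
    (P := fun m => v (φ (f.coeff m)) = v (φ (f.coeff n₀))) hn₀ rfl
  have hle : ∀ q, v (φ (f.coeff q)) ≤ v (φ (f.coeff m)) := by
    intro q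
    by_cases hq : f.coeff q = 0
    · rw [hq, map_zero, map_zero]; exact zero_le
    · rw [hm]; exact hmax q (Finsupp.mem_support_iff.2 hq)
  have hpos : 0 < v (φ (f.coeff m)) := by rw [hm]; exact zero_lt_one.trans hone
  have hlt : ∀ q, m < q → v (φ (f.coeff q)) < v (φ (f.coeff m)) := by
    intro q hq
    by_cases hq0 : f.coeff q = 0
    · rw [hq0, map_zero, map_zero]; exact hpos
    · exact lt_of_le_of_ne (hle q) fun h => hmtop q hq hq0 (h.trans hm)
  have hkey := coeff_mul_sub_mem
    ((v.ltAddSubgroup (Units.mk0 _ (mul_pos hpos hpos).ne')).comap φ.toAddMonoidHom) f f m m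
    (fun p q hpq hne => by
      change v (φ (f.coeff p * f.coeff q)) < v (φ (f.coeff m)) * v (φ (f.coeff m))
      rw [map_mul, map_mul]
      rcases lt_or_lt_of_mul_eq hpq hne with h | h
      · exact mul_lt_mul_of_lt_of_le_of_nonneg_of_pos (hlt p h) (hle q) zero_le hpos
      · exact mul_lt_mul_of_le_of_lt_of_nonneg_of_pos (hle p) (hlt q h) zero_le hpos)
  change v (φ ((f * f).coeff (m * m) - f.coeff m * f.coeff m)) <
    v (φ (f.coeff m)) * v (φ (f.coeff m)) at hkey
  have hA : v (φ ((f * f).coeff (m * m))) ≤ 1 :=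
    (V.valuation_le_one_iff _).2 (hAV ⟨_, by rw [← sq]; exact hf _⟩)
  have h1 : 1 < v (φ (f.coeff m)) * v (φ (f.coeff m)) := by
    rw [hm]; exact one_lt_mul'' hone hone
  rw [map_sub, map_mul φ, ← map_mul v, Valuation.map_sub_swap,
    Valuation.map_sub_eq_of_lt_left] at hkey
  · exact lt_irrefl _ hkey
  · rw [map_mul v]; exact hA.trans_lt h1

theorem mul_mem_of_isIntegral {B : Type*} [CommRing B] {A : Subring B}
    (hA : ∀ b, b ^ 2 ∈ A → b ^ 3 ∈ A → b ∈ A) {a b : B} (ha : a ∈ A) (hb : IsIntegral A b)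
    {k : ℕ} (hk : a ^ k * b ∈ A) : a * b ∈ A := by
  obtain ⟨p, hp, hpb⟩ := hb
  -- One power of `a` clears all powers of `b`: low ones through `a ^ k * b`, the rest by the monic
  -- equation.
  have key : ∀ j, a ^ (k * p.natDegree) * b ^ j ∈ A := by
    intro j
    induction j using Nat.strong_induction_on with
    | _ j ih =>
      rcases lt_or_ge j p.natDegree with hj | hj
      · obtain ⟨e, he⟩ := Nat.exists_eq_add_of_le hj.le
        have : a ^ (k * p.natDegree) * b ^ j = a ^ (k * e) * (a ^ k * b) ^ j := by
          rw [he]; ring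
        rw [this]
        exact A.mul_mem (A.pow_mem ha _) (A.pow_mem hk _)
      · obtain ⟨e, rfl⟩ := Nat.exists_eq_add_of_le hj
        have h0 : b ^ p.natDegree =
            -∑ i ∈ Finset.range p.natDegree, (p.coeff i : B) * b ^ i := by
          rw [hp.as_sum, eval₂_add, eval₂_finsetSum] at hpb
          simp only [eval₂_X_pow, eval₂_mul, eval₂_C] at hpb
          exact eq_neg_of_add_eq_zero_left hpb
        rw [pow_add, h0, neg_mul, mul_neg, Finset.sum_mul, Finset.mul_sum]
        refine A.neg_mem (A.sum_mem fun i hi => ?_)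
        have : a ^ (k * p.natDegree) * ((p.coeff i : B) * b ^ i * b ^ e) =
            (p.coeff i : B) * (a ^ (k * p.natDegree) * b ^ (i + e)) := by ring
        rw [this]
        exact A.mul_mem (p.coeff i).2 (ih _ (by have := Finset.mem_range.1 hi; omega))
  refine mem_of_forall_pow_mem (T := A.toSubmonoid) hA (J := k * p.natDegree) fun j hj => ?_
  obtain ⟨e, rfl⟩ := Nat.exists_eq_add_of_le hj
  have : (a * b) ^ (k * p.natDegree + e) =
      a ^ e * (a ^ (k * p.natDegree) * b ^ (k * p.natDegree + e)) := by ring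
  change (a * b) ^ (k * p.natDegree + e) ∈ A
  rw [this]
  exact A.mul_mem (A.pow_mem ha _) (key _)

end Integral

/-! ### Coefficients of `f` lie in `A` -/

section Coefficients

/-- The elements of `B` multiplied into the subring `A` by some power of `a`. -/
def powTransporter {B : Type*} [CommRing B] (A : Subring B) (a : A) : AddSubgroup B where
  carrier := {b | ∃ k : ℕ, (a : B) ^ k * b ∈ A}
  zero_mem' := ⟨0, by simp⟩
  neg_mem' := by
    rintro x ⟨k, hk⟩
    exact ⟨k, by rw [mul_neg]; exact A.neg_mem hk⟩
  add_mem' := by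
    rintro x y ⟨k, hk⟩ ⟨l, hl⟩
    refine ⟨k + l, ?_⟩
    have : (a : B) ^ (k + l) * (x + y) =
      (a : B) ^ l * ((a : B) ^ k * x) + (a : B) ^ k * ((a : B) ^ l * y) := by ring
    rw [this]
    exact A.add_mem (A.mul_mem (A.pow_mem a.2 _) hk) (A.mul_mem (A.pow_mem a.2 _) hl)

theorem mul_mem_powTransporter {B : Type*} [CommRing B] {A : Subring B} {a : A} {x y : B}
    (hx : x ∈ A) (hy : y ∈ powTransporter A a) : x * y ∈ powTransporter A a := by
  obtain ⟨k, hk⟩ := hy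
  exact ⟨k, by rw [mul_left_comm]; exact A.mul_mem hx hk⟩

theorem mem_monoidSubalgebra_top {B N : Type*} [CommRing B] [CancelCommMonoid N]
    [IsMulTorsionFree N] {A : Subring B} (hA : ∀ b, b ^ 2 ∈ A → b ^ 3 ∈ A → b ∈ A)
    (f : MonoidAlgebra B N) (h2 : f ^ 2 ∈ monoidSubalgebra A (⊤ : Submonoid N))
    (h3 : f ^ 3 ∈ monoidSubalgebra A (⊤ : Submonoid N)) :
    f ∈ monoidSubalgebra A (⊤ : Submonoid N) := by
  obtain ⟨_, _⟩ := exists_linearOrder N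
  have hmem : ∀ g : MonoidAlgebra B N,
      g ∈ monoidSubalgebra A (⊤ : Submonoid N) ↔ ∀ n, g.coeff n ∈ A := fun g => by
    simp [mem_monoidSubalgebra]
  refine mem_of_exists_term _ (fun f hf h2 h3 => ?_) f h2 h3
  rw [hmem] at h2 h3
  obtain ⟨n, hn, htop⟩ := exists_leading hf
  have htop2 : ∀ p, n * n < p → (f ^ 2).coeff p = 0 := by
    rw [sq]; exact coeff_mul_of_lt htop htop
  have hc2 : (f ^ 2).coeff (n * n) = f.coeff n ^ 2 := by
    rw [sq, coeff_mul_of_leading htop htop, sq]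
  have ha : f.coeff n ∈ A := by
    refine hA _ (hc2 ▸ h2 _) ?_
    have := coeff_mul_of_leading htop2 htop
    rw [hc2, ← pow_succ, ← pow_succ] at this
    exact this ▸ h3 _
  have hW : ∀ m, f.coeff m ∈ powTransporter A ⟨f.coeff n, ha⟩ := by
    by_contra! hbad
    obtain ⟨m, hm⟩ := hbad
    obtain ⟨m, -, hm, hmax⟩ := exists_maximal_coeff (f := f) (n := m)
      (P := fun m => f.coeff m ∉ powTransporter A ⟨f.coeff n, ha⟩)
      (fun h => hm (h ▸ zero_mem _)) hm
    refine hm ?_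
    -- At `n * n * m` in `f ^ 2 * f`, any other contribution either vanishes or involves a
    -- coefficient beyond `m`, already in the transporter.
    have h := coeff_mul_sub_mem (powTransporter A ⟨f.coeff n, ha⟩) (f ^ 2) f (n * n) m
      (fun p q hpq hne => by
        rcases lt_or_lt_of_mul_eq hpq hne with h | h
        · rw [htop2 p h, zero_mul]
          exact zero_mem _
        · refine mul_mem_powTransporter (h2 p) ?_
          by_cases hq : f.coeff q = 0
          · exact hq ▸ zero_mem _
          · exact not_not.1 (hmax q h hq))
    have h' : (f ^ 2 * f).coeff (n * n * m) ∈ powTransporter A ⟨f.coeff n, ha⟩ :=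
      ⟨0, by rw [pow_zero, one_mul, ← pow_succ]; exact h3 _⟩
    obtain ⟨k, hk⟩ := sub_mem h' h
    rw [sub_sub_cancel] at hk
    refine ⟨k + 2, ?_⟩
    rw [hc2] at hk
    rwa [pow_add, mul_assoc]
  refine ⟨n, hn, single_mem_monoidSubalgebra ha trivial, (hmem _).2 fun m => ?_⟩
  by_cases hm : (MonoidAlgebra.single n (f.coeff n) * f).coeff m = 0
  · exact hm ▸ A.zero_mem
  · obtain ⟨q, rfl, -⟩ := coeff_single_mul_ne_zero hm
    rw [coeff_single_mul_mem]
    obtain ⟨k, hk⟩ := hW q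
    exact mul_mem_of_isIntegral hA ha (isIntegral_coeff_of_sq h2 q) hk

end Coefficients

/-! ### Exponents of `f` lie in `M` -/

section Support

variable {B N : Type*} [CommRing B] [CancelCommMonoid N]

/-- Otherwise some order has `n < 1` and `M` above `1`. The lowest exponent `m` of `f` is then below
`1`, yet `m * m` occurs in `f ^ 2`, there being no zero divisors. -/
theorem exists_pow_mem_of_sq [IsDomain B] [IsMulTorsionFree N] {M : Submonoid N}
    (hM : IsPositive M) {f : MonoidAlgebra B N} (hf : ∀ n, (f ^ 2).coeff n ≠ 0 → n ∈ M) {n : N}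
    (hn : f.coeff n ≠ 0) : ∃ k ≥ 1, n ^ k ∈ M := by
  by_contra! hk
  obtain ⟨l, hl, hM1, hn1⟩ := exists_linearOrder_lt_one hM hk
  obtain ⟨m, hm, hmin⟩ := f.coeff.support.exists_min_image id ⟨n, Finsupp.mem_support_iff.2 hn⟩
  have hm1 : m < 1 := (hmin n (Finsupp.mem_support_iff.2 hn)).trans_lt hn1
  have hlow : ∀ p, p < m → f.coeff p = 0 := fun p hp => by
    by_contra h
    exact absurd (hmin p (Finsupp.mem_support_iff.2 h)) (not_le.2 hp)
  have hsq : (f ^ 2).coeff (m * m) = f.coeff m * f.coeff m := by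
    rw [sq]
    refine coeff_mul_of_unique f f m m fun p q hpq hne => ?_
    -- Reversing the equation turns the leading-term dichotomy into one for lowest terms.
    rcases lt_or_lt_of_mul_eq hpq.symm hne.symm with h | h
    · rw [hlow p h, zero_mul]
    · rw [hlow q h, mul_zero]
  have hm0 : f.coeff m ≠ 0 := Finsupp.mem_support_iff.1 hm
  exact absurd (hM1 _ (hf (m * m) (hsq ▸ mul_ne_zero hm0 hm0)))
    (not_le.2 (mul_lt_one' hm1 hm1))

theorem mul_mem_of_exists_pow_mem {M : Submonoid N}
    (hM : ∀ x, x ^ 2 ∈ M → x ^ 3 ∈ M → x ∈ M) {m n : N} (hm : m ∈ M) {d : ℕ} (hd : 1 ≤ d)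
    (hn : n ^ d ∈ M) {k : ℕ} (hk : m ^ k * n ∈ M) : m * n ∈ M := by
  refine mem_of_forall_pow_mem hM (J := k * d) fun j hj => ?_
  obtain ⟨e, he⟩ := Nat.exists_eq_add_of_le ((Nat.mul_le_mul_left k (Nat.mod_lt j hd).le).trans hj)
  -- Divide `j` by `d`: only the remainder needs help from `m ^ k`, costing fewer than `k * d + 1`
  -- factors `m`.
  have : (m * n) ^ j = m ^ e * ((m ^ k * n) ^ (j % d) * (n ^ d) ^ (j / d)) := by
    rw [mul_pow, mul_pow, ← pow_mul, ← pow_mul, mul_assoc, ← pow_add, Nat.mod_add_div,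
      ← mul_assoc, ← pow_add, add_comm, ← he]
  rw [this]
  exact M.mul_mem (M.pow_mem hm _) (M.mul_mem (M.pow_mem hk _) (M.pow_mem hn _))

theorem mem_monoidSubalgebra_of_isDomain [IsDomain B] [IsMulTorsionFree N] {M : Submonoid N}
    (hpos : IsPositive M) (hM : ∀ x, x ^ 2 ∈ M → x ^ 3 ∈ M → x ∈ M) (f : MonoidAlgebra B N)
    (h2 : f ^ 2 ∈ monoidSubalgebra ⊤ M) (h3 : f ^ 3 ∈ monoidSubalgebra ⊤ M) :
    f ∈ monoidSubalgebra ⊤ M := by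
  obtain ⟨_, _⟩ := exists_linearOrder N
  have hmem : ∀ g : MonoidAlgebra B N,
      g ∈ monoidSubalgebra ⊤ M ↔ ∀ n, g.coeff n ≠ 0 → n ∈ M := fun g => by
    simp [mem_monoidSubalgebra]
  refine mem_of_exists_term _ (fun f hf h2 h3 => ?_) f h2 h3
  rw [hmem] at h2 h3
  obtain ⟨n, hn, htop⟩ := exists_leading hf
  have htop2 : ∀ p, n * n < p → (f ^ 2).coeff p = 0 := by
    rw [sq]; exact coeff_mul_of_lt htop htop
  have hc2 : (f ^ 2).coeff (n * n) ≠ 0 := by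
    rw [sq, coeff_mul_of_leading htop htop]
    exact mul_ne_zero hn hn
  have hn2 : n * n ∈ M := h2 _ hc2
  have hnM : n ∈ M := by
    refine hM _ (by rwa [sq]) ?_
    rw [pow_succ, sq]
    refine h3 _ ?_
    rw [pow_succ, coeff_mul_of_leading htop2 htop]
    exact mul_ne_zero hc2 hn
  have hW : ∀ m, f.coeff m ≠ 0 → ∃ k : ℕ, n ^ k * m ∈ M := by
    by_contra! hbad
    obtain ⟨m, hm0, hm⟩ := hbad
    obtain ⟨m, hm0, hm, hmax⟩ := exists_maximal_coeff (f := f) (n := m)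
      (P := fun m => ∀ k : ℕ, n ^ k * m ∉ M) hm0 hm
    have h := coeff_mul_of_unique (f ^ 2) f (n * n) m (fun p q hpq hne => by
      rcases lt_or_lt_of_mul_eq hpq hne with h | h
      · rw [htop2 p h, zero_mul]
      · by_contra hpq0
        have hp := h2 p (left_ne_zero_of_mul hpq0)
        have hq := hmax q h (right_ne_zero_of_mul hpq0)
        push Not at hq
        obtain ⟨k, hk⟩ := hq
        refine hm (k + 2) ?_
        rw [pow_add, sq, mul_assoc, ← hpq, mul_left_comm]
        exact M.mul_mem hp hk)
    refine hm 2 ?_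
    rw [sq]
    refine h3 _ ?_
    rw [pow_succ, h]
    exact mul_ne_zero hc2 hm0
  refine ⟨n, hn, single_mem_monoidSubalgebra trivial hnM, (hmem _).2 fun m hm => ?_⟩
  obtain ⟨q, rfl, hq⟩ := coeff_single_mul_ne_zero hm
  obtain ⟨k, hk⟩ := hW q hq
  obtain ⟨d, hd, hqd⟩ := exists_pow_mem_of_sq hpos h2 hq
  exact mul_mem_of_exists_pow_mem hM hnM hd hqd hk

/-- A nonzero coefficient survives modulo some prime, which reduces to the domain case. -/
theorem support_subset_of_isReduced [IsReduced B] [IsMulTorsionFree N] {M : Submonoid N}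
    (hpos : IsPositive M) (hM : ∀ x, x ^ 2 ∈ M → x ^ 3 ∈ M → x ∈ M) {f : MonoidAlgebra B N}
    (h2 : ∀ n, (f ^ 2).coeff n ≠ 0 → n ∈ M) (h3 : ∀ n, (f ^ 3).coeff n ≠ 0 → n ∈ M) {n : N}
    (hn : f.coeff n ≠ 0) : n ∈ M := by
  have hnil : f.coeff n ∉ nilradical B := fun h => hn (mem_nilradical.1 h).eq_zero
  rw [nilradical_eq_sInf, Ideal.mem_sInf] at hnil
  push Not at hnil
  obtain ⟨P, hP, hnP⟩ := hnil
  have : P.IsPrime := hP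
  let φ := MonoidAlgebra.mapRingHom N (Ideal.Quotient.mk P)
  have hφ : ∀ g : MonoidAlgebra B N, (∀ n, g.coeff n ≠ 0 → n ∈ M) →
      φ g ∈ monoidSubalgebra (⊤ : Subring (B ⧸ P)) M := fun g hg =>
    mem_monoidSubalgebra.2 ⟨fun _ => trivial, fun n hn => hg n fun h => hn (by
      rw [MonoidAlgebra.coeff_mapRingHom, h, map_zero])⟩
  have hf := mem_monoidSubalgebra_of_isDomain hpos hM (φ f) (by rw [← map_pow]; exact hφ _ h2)
    (by rw [← map_pow]; exact hφ _ h3)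
  refine (mem_monoidSubalgebra.1 hf).2 n ?_
  rw [MonoidAlgebra.coeff_mapRingHom]
  exact fun h => hnP (Ideal.Quotient.eq_zero_iff_mem.1 h)

end Support

end SubintegralExt

open SubintegralExt in
theorem corollary1p3 {B N : Type*} [CommRing B] [CancelCommMonoid N] [IsMulTorsionFree N]
    (A : Subring B) (M : Submonoid N)
    (hMpos : SubintegralExt.IsPositive M) (hNpos : SubintegralExt.IsPositive N)
    (hA : SubintegralExt.RingSubintegrallyClosed A)
    (hM : SubintegralExt.MonoidSubintegrallyClosed M) :
    ((IsReduced B ∨ M = ⊤) →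
      SubintegralExt.RingSubintegrallyClosed (SubintegralExt.monoidSubalgebra A M)) ∧
    (SubintegralExt.RingSubintegrallyClosed (SubintegralExt.monoidSubalgebra A M) →
      Monoid.FG N → IsReduced B ∨ M = ⊤) := by
  refine ⟨fun h => ?_, fun h _ => ?_⟩
  · rw [ringSubintegrallyClosed_iff] at hA ⊢
    intro f h2 h3
    have htop : ∀ g : MonoidAlgebra B N, g ∈ monoidSubalgebra A M →
        g ∈ monoidSubalgebra A (⊤ : Submonoid N) := fun g hg =>
      mem_monoidSubalgebra.2 ⟨(mem_monoidSubalgebra.1 hg).1, fun _ _ => trivial⟩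
    have hf := mem_monoidSubalgebra_top hA f (htop _ h2) (htop _ h3)
    rcases h with h | rfl
    · exact mem_monoidSubalgebra.2 ⟨(mem_monoidSubalgebra.1 hf).1, fun n =>
        support_subset_of_isReduced hMpos hM.mem (mem_monoidSubalgebra.1 h2).2
          (mem_monoidSubalgebra.1 h3).2⟩
    · exact hf
  · by_contra! hne
    obtain ⟨hB, hMN⟩ := hne
    obtain ⟨n, hn⟩ := SetLike.exists_not_mem_of_ne_top M hMN
    refine hB ((isReduced_iff_pow_one_lt 2 one_lt_two).2 fun b hb => ?_)
    by_contra hb0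
    rw [ringSubintegrallyClosed_iff] at h
    have hs2 : MonoidAlgebra.single n b ^ 2 = 0 := by
      rw [MonoidAlgebra.single_pow, hb, MonoidAlgebra.single_zero]
    have hs := h (MonoidAlgebra.single n b) (hs2 ▸ Subring.zero_mem _)
      (by rw [pow_succ, hs2, zero_mul]; exact Subring.zero_mem _)
    exact hn ((mem_monoidSubalgebra.1 hs).2 n (by simpa using hb0))
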